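/- Let $d\ge 0$ be an integer. Let $\mu\in\mathcal S'(\mathbb R^d)$ be a tempered distribution. For an invertible real $2d\times 2d$ matrix $T=\begin{pmatrix}A_0&B_0\\C_0&D_0\end{pmatrix}$ with $d\times d$ blocks, the matrix-Wigner transform of $\mu$ is the tempered distribution $W_T(\mu)=\mathcal F_2\big(P_T(\mu\otimes\overline\mu)\big)\in\mathcal S'(\mathbb R^d_x\times\mathbb R^d_\omega)$, where $P_T\Phi=\Phi\circ T$ is the linear change of variables and $\mathcal F_2F(x,\omega)=\int_{\mathbb R^d}F(x,t)e^{-2\pi i\,\omega\cdot t}\,dt$ is the partial Fourier transform, both extended to tempered distributions in the usual way; thus $W_T(\mu)(x,\omega)=\int e^{-2\pi i\,t\cdot\omega}\mu(A_0x+B_0t)\overline{\mu(C_0x+D_0t)}\,dt$ for $\mu\in\mathcal S(\mathbb R^d)$. The ambiguity function is $\mathrm{Amb}(\mu)=W_T(\mu)$ with $T=\begin{pmatrix}\frac12\mathrm{Id}&\mathrm{Id}\\-\frac12\mathrm{Id}&\mathrm{Id}\end{pmatrix}$. Let $\Pi_1(x,\omega)=x$. A set $S\subset\mathbb R^d$ is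 called discrete if it has no accumulation point in $\mathbb R^d$, and uniformly discrete if there is $\delta>0$ with $|r-s|\ge\delta$ for all distinct $r,s\in S$. Let $A_0,C_0$ be real $d\times d$ matrices with $\det(A_0-C_0)\ne0$, and put $T_{A_0,C_0}=\begin{pmatrix}A_0&\mathrm{Id}\\C_0&\mathrm{Id}\end{pmatrix}$ (which is then invertible). If $\Pi_1(\operatorname{supp}W_{T_{A_0,C_0}}(\mu))$ is discrete, then $$\Pi_1\big(\operatorname{supp}W_{T_{A_0,C_0}}(\mu)\big)=(A_0-C_0)^{-1}\big(\operatorname{supp}\mu-\operatorname{supp}\mu\big),$$ and $\operatorname{supp}\mu$ is uniformly discrete. In particular, if $\Pi_1(\operatorname{supp}\mathrm{Amb}(\mu))$ is discrete, then $\Pi_1(\operatorname{supp}\mathrm{Amb}(\mu))=\operatorname{supp}\mu-\operatorname{supp}\mu$. -/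

import Mathlib

open scoped SchwartzMap FourierTransform LineDeriv Pointwise
open Filter Topology

noncomputable section

namespace MatrixWigner

section Slice

variable {E F V : Type} [NormedAddCommGroup E] [NormedSpace ℝ E]
  [NormedAddCommGroup F] [NormedSpace ℝ F] [NormedAddCommGroup V] [NormedSpace ℝ V]

/-- The partial map `t ↦ f (x, t)` of a Schwartz function `f`. -/
def slice (𝕜 : Type) [RCLike 𝕜] [NormedSpace 𝕜 V] [SMulCommClass ℝ 𝕜 V] (x : E) :
    𝓢(E × F, V) →L[𝕜] 𝓢(F, V) :=
  SchwartzMap.compCLM 𝕜 (g := fun t : F => (x, t))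
    (by
      have h : (fun t : F => (x, t)) = fun t => ContinuousLinearMap.inr ℝ E F t + (x, (0 : F)) := by
        ext t <;> simp
      rw [h]
      fun_prop)
    ⟨1, 1, fun t => by
      have : ‖t‖ ≤ ‖(x, t)‖ := norm_snd_le (x, t)
      simp only [pow_one, one_mul]
      linarith⟩

@[simp]
theorem slice_apply (𝕜 : Type) [RCLike 𝕜] [NormedSpace 𝕜 V] [SMulCommClass ℝ 𝕜 V] (x : E)
    (f : 𝓢(E × F, V)) (t : F) : slice 𝕜 x f t = f (x, t) := rfl

/-- The partial derivative in the second variable. -/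
def dSnd : 𝓢(E × F, V) →L[ℝ] 𝓢(E × F, F →L[ℝ] V) :=
  (SchwartzMap.postcompCLM (𝕜 := ℝ)
    (ContinuousLinearMap.precomp V (ContinuousLinearMap.inr ℝ E F))).comp
    (SchwartzMap.fderivCLM ℝ (E × F) V)

theorem dSnd_apply (f : 𝓢(E × F, V)) (z : E × F) :
    dSnd f z = (fderiv ℝ f z).comp (ContinuousLinearMap.inr ℝ E F) := rfl

theorem fderiv_partial (f : 𝓢(E × F, V)) (x : E) :
    fderiv ℝ (fun t => f (x, t)) = fun t => dSnd f (x, t) := by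
  ext1 t
  have h2 : HasFDerivAt (fun t : F => (x, t)) (ContinuousLinearMap.inr ℝ E F) t :=
    hasFDerivAt_prodMk_right x t
  exact ((f.hasFDerivAt (x, t)).comp t h2).fderiv

theorem partial_decay (k j : ℕ) (n : ℕ) : ∀ (V : Type) [NormedAddCommGroup V] [NormedSpace ℝ V],
    ∃ q : Seminorm ℝ 𝓢(E × F, V), Continuous q ∧ ∀ (f : 𝓢(E × F, V)) (x : E) (t : F),
      ‖x‖ ^ k * (‖t‖ ^ j * ‖iteratedFDeriv ℝ n (fun t => f (x, t)) t‖) ≤ q f := by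
  induction n with
  | zero =>
    intro V _ _
    refine ⟨SchwartzMap.seminorm ℝ (k + j) 0,
      (schwartz_withSeminorms ℝ (E × F) V).continuous_seminorm (k + j, 0), fun f x t => ?_⟩
    refine le_trans ?_ (SchwartzMap.norm_pow_mul_le_seminorm ℝ f (k + j) (x, t))
    rw [norm_iteratedFDeriv_zero, pow_add, mul_assoc]
    gcongr
    · exact norm_fst_le (x, t)
    · exact norm_snd_le (x, t)
  | succ n ih =>
    intro V _ _
    obtain ⟨q, hq, h⟩ := ih (F →L[ℝ] V)
    refine ⟨q.comp (dSnd (E := E) (F := F) (V := V)).toLinearMap,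
      hq.comp dSnd.continuous, fun f x t => ?_⟩
    rw [← norm_iteratedFDeriv_fderiv, fderiv_partial]
    exact h (dSnd f) x t

/-- The first order Taylor remainder of `f` in the first variable. -/
theorem partial_taylor (j : ℕ) (n : ℕ) : ∀ (V : Type) [NormedAddCommGroup V] [NormedSpace ℝ V],
    ∃ q : Seminorm ℝ 𝓢(E × F, V), Continuous q ∧ ∀ (f : 𝓢(E × F, V)) (x h : E) (t : F),
      ‖t‖ ^ j * ‖iteratedFDeriv ℝ n
        (fun t => f (x + h, t) - f (x, t) - ∂_{(h, (0 : F))} f (x, t)) t‖ ≤ ‖h‖ ^ 2 * q f := by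
  induction n with
  | zero =>
    intro V _ _
    refine ⟨SchwartzMap.seminorm ℝ j 2,
      (schwartz_withSeminorms ℝ (E × F) V).continuous_seminorm (j, 2), fun f x h t => ?_⟩
    rw [norm_iteratedFDeriv_zero, SchwartzMap.lineDerivOp_apply_eq_fderiv]
    set S := SchwartzMap.seminorm ℝ j 2 f with hS
    have hD (y : E) : ‖t‖ ^ j * ‖fderiv ℝ (fderiv ℝ f) (y, t)‖ ≤ S := by
      refine le_trans ?_ (SchwartzMap.le_seminorm ℝ j 2 f (y, t))
      rw [← norm_iteratedFDeriv_fderiv, ← norm_iteratedFDeriv_fderiv, norm_iteratedFDeriv_zero]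
      gcongr
      exact norm_snd_le (y, t)
    change _ ≤ ‖h‖ ^ 2 * S
    rcases eq_or_ne (‖t‖ ^ j) 0 with h0 | h0
    · have hS0 : 0 ≤ S := apply_nonneg _ _
      rw [h0, zero_mul]
      positivity
    have hpos : 0 < ‖t‖ ^ j := lt_of_le_of_ne (by positivity) h0.symm
    have hD' (y : E) : ‖fderiv ℝ (fderiv ℝ f) (y, t)‖ ≤ S / ‖t‖ ^ j := by
      rw [le_div_iff₀ hpos, mul_comm]
      exact hD y
    have hdiff : Differentiable ℝ (fderiv ℝ f) :=
      (SchwartzMap.fderivCLM ℝ (E × F) V f).differentiable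
    -- Lipschitz bound of the derivative along the horizontal line
    have hlip (y : E) : ‖fderiv ℝ f (y, t) - fderiv ℝ f (x, t)‖ ≤ S / ‖t‖ ^ j * ‖y - x‖ := by
      have hder (y : E) : HasFDerivAt (fun y => fderiv ℝ f (y, t))
          ((fderiv ℝ (fderiv ℝ f) (y, t)).comp (ContinuousLinearMap.inl ℝ E F)) y :=
        (hdiff (y, t)).hasFDerivAt.comp y (hasFDerivAt_prodMk_left y t)
      refine convex_univ.norm_image_sub_le_of_norm_hasFDerivWithin_le
        (fun y _ => (hder y).hasFDerivWithinAt) (fun y _ => ?_) (Set.mem_univ x) (Set.mem_univ y)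
      refine (ContinuousLinearMap.opNorm_comp_le _ _).trans ?_
      calc _ ≤ ‖fderiv ℝ (fderiv ℝ f) (y, t)‖ * 1 := by
            gcongr
            exact ContinuousLinearMap.norm_inl_le_one ℝ E F
        _ ≤ _ := by rw [mul_one]; exact hD' y
    have hder (y : E) : HasFDerivAt (fun y => f (y, t))
        ((fderiv ℝ f (y, t)).comp (ContinuousLinearMap.inl ℝ E F)) y :=
      (f.hasFDerivAt (y, t)).comp y (hasFDerivAt_prodMk_left y t)
    have hS0 : 0 ≤ S := apply_nonneg _ _
    have key := (convex_segment x (x + h)).norm_image_sub_le_of_norm_hasFDerivWithin_le'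
      (φ := (fderiv ℝ f (x, t)).comp (ContinuousLinearMap.inl ℝ E F))
      (C := S / ‖t‖ ^ j * ‖h‖)
      (fun y _ => (hder y).hasFDerivWithinAt) (fun y hy => ?_)
      (left_mem_segment ℝ x (x + h)) (right_mem_segment ℝ x (x + h))
    · rw [add_sub_cancel_left] at key
      calc _ ≤ ‖t‖ ^ j * (S / ‖t‖ ^ j * ‖h‖ * ‖h‖) := by
            gcongr
            exact key
        _ = _ := by field_simp
    · rw [← ContinuousLinearMap.sub_comp]
      refine (ContinuousLinearMap.opNorm_comp_le _ _).trans ?_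
      have hyx : ‖y - x‖ ≤ ‖h‖ := by
        have := norm_sub_le_of_mem_segment hy
        simpa using this
      calc _ ≤ ‖fderiv ℝ f (y, t) - fderiv ℝ f (x, t)‖ * 1 := by
            gcongr
            exact ContinuousLinearMap.norm_inl_le_one ℝ E F
        _ ≤ S / ‖t‖ ^ j * ‖y - x‖ := by rw [mul_one]; exact hlip y
        _ ≤ _ := by gcongr
  | succ n ih =>
    intro V _ _
    obtain ⟨q, hq, H⟩ := ih (F →L[ℝ] V)
    refine ⟨q.comp (dSnd (E := E) (F := F) (V := V)).toLinearMap,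
      hq.comp dSnd.continuous, fun f x h t => ?_⟩
    have hsymm (z : E × F) : dSnd (∂_{(h, (0 : F))} f) z = ∂_{(h, (0 : F))} (dSnd f) z := by
      have hdiff : Differentiable ℝ (fderiv ℝ f) :=
        (SchwartzMap.fderivCLM ℝ (E × F) V f).differentiable
      have e1 : (∂_{(h, (0 : F))} f : 𝓢(E × F, V)) = fun z => fderiv ℝ f z (h, 0) := by
        ext z; exact SchwartzMap.lineDerivOp_apply_eq_fderiv _ _ _
      have e2 : (dSnd f : E × F → F →L[ℝ] V) =
        fun z => (ContinuousLinearMap.precomp V (ContinuousLinearMap.inr ℝ E F)) (fderiv ℝ f z) :=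
        rfl
      rw [SchwartzMap.lineDerivOp_apply_eq_fderiv, dSnd_apply, e1, e2]
      have h1 : HasFDerivAt (fun z => fderiv ℝ f z (h, 0))
          ((fderiv ℝ (fderiv ℝ f) z).flip (h, 0)) z :=
        ((ContinuousLinearMap.apply ℝ V (h, (0 : F))).hasFDerivAt).comp z (hdiff z).hasFDerivAt
      have h2 : HasFDerivAt (fun z => (ContinuousLinearMap.precomp V
          (ContinuousLinearMap.inr ℝ E F)) (fderiv ℝ f z)) _ z :=
        (ContinuousLinearMap.hasFDerivAt _).comp z (hdiff z).hasFDerivAt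
      rw [h1.fderiv, h2.fderiv]
      ext k
      have := second_derivative_symmetric (f := f) (f' := fderiv ℝ f)
        (fun y => f.hasFDerivAt y) (hdiff z).hasFDerivAt (h, 0) (0, k)
      simpa using this.symm
    rw [← norm_iteratedFDeriv_fderiv]
    have hd : fderiv ℝ (fun t => f (x + h, t) - f (x, t) - ∂_{(h, (0 : F))} f (x, t)) =
        fun t => dSnd f (x + h, t) - dSnd f (x, t) - ∂_{(h, (0 : F))} (dSnd f) (x, t) := by
      ext1 t
      have hg (g : 𝓢(E × F, V)) (x : E) : HasFDerivAt (fun t => g (x, t)) (dSnd g (x, t)) t :=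
        (g.hasFDerivAt (x, t)).comp t (hasFDerivAt_prodMk_right x t)
      rw [← hsymm]
      exact (((hg f (x + h)).sub (hg f x)).sub (hg _ x)).fderiv
    rw [hd]
    exact H (dSnd f) x h t

end Slice
theorem seminorm_sum_apply {𝕜 G ι : Type} [RCLike 𝕜] [AddCommGroup G] [Module 𝕜 G]
    (s : Finset ι) (p : ι → Seminorm 𝕜 G) (f : G) : (∑ i ∈ s, p i) f = ∑ i ∈ s, p i f := by
  classical
  induction s using Finset.induction_on with
  | empty => rfl
  | insert m s hm ih => rw [Finset.sum_insert hm, Finset.sum_insert hm, ← ih]; rfl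

section Construction

variable {D X : Type} [NormedAddCommGroup D] [NormedSpace ℝ D]
  [NormedAddCommGroup X] [NormedSpace ℝ X] [FiniteDimensional ℝ X]

theorem contDiff_of_deriv (A : 𝓢(D, ℂ) → X → ℂ) (dd : X → 𝓢(D, ℂ) →L[ℂ] 𝓢(D, ℂ))
    (hder : ∀ f x, ∃ L : X →L[ℝ] ℂ, HasFDerivAt (A f) L x ∧ ∀ h, L h = A (dd h f) x)
    (f : 𝓢(D, ℂ)) : ContDiff ℝ (⊤ : ℕ∞) (A f) := by
  rw [contDiff_infty]
  intro n
  induction n generalizing f with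
  | zero =>
    refine contDiff_zero.2 (continuous_iff_continuousAt.2 fun x => ?_)
    obtain ⟨L, hL, -⟩ := hder f x
    exact hL.continuousAt
  | succ n ih =>
    push_cast
    rw [contDiff_succ_iff_fderiv_apply]
    refine ⟨fun x => ?_, by simp, fun y => ?_⟩
    · obtain ⟨L, hL, -⟩ := hder f x
      exact hL.differentiableAt
    · convert ih (dd y f) using 2 with x
      obtain ⟨L, hL, hL'⟩ := hder f x
      rw [hL.fderiv, hL']

theorem bound_of_deriv (A : 𝓢(D, ℂ) → X → ℂ) (dd : X → 𝓢(D, ℂ) →L[ℂ] 𝓢(D, ℂ))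
    (hder : ∀ f x, ∃ L : X →L[ℝ] ℂ, HasFDerivAt (A f) L x ∧ ∀ h, L h = A (dd h f) x)
    (k : ℕ) (h0 : ∃ q : Seminorm ℂ 𝓢(D, ℂ), Continuous q ∧ ∀ f x, ‖x‖ ^ k * ‖A f x‖ ≤ q f)
    (n : ℕ) : ∃ q : Seminorm ℂ 𝓢(D, ℂ), Continuous q ∧
      ∀ f x, ‖x‖ ^ k * ‖iteratedFDeriv ℝ n (A f) x‖ ≤ q f := by
  induction n with
  | zero => simpa only [norm_iteratedFDeriv_zero] using h0
  | succ n ih =>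
    obtain ⟨q, hq, H⟩ := ih
    let b := Module.finBasis ℝ X
    let c (i) : X →L[ℝ] ℝ := LinearMap.toContinuousLinearMap (b.coord i)
    let T (i) : ℂ →L[ℝ] (X →L[ℝ] ℂ) := ContinuousLinearMap.smulRightL ℝ X ℂ (c i)
    have hA (f) : fderiv ℝ (A f) = fun x => ∑ i, (T i ∘ A (dd (b i) f)) x := by
      ext1 x
      obtain ⟨L, hL, hL'⟩ := hder f x
      rw [hL.fderiv]
      ext y
      conv_lhs => rw [← b.sum_repr y, map_sum]
      have e (i) : L (b.repr y i • b i) = b.repr y i • A (dd (b i) f) x := by rw [map_smul, hL']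
      simp only [e]
      simp [T, c]
    have hcd := contDiff_of_deriv A dd hder
    refine ⟨∑ i, ‖T i‖₊ • q.comp (dd (b i)).toLinearMap, ?_, fun f x => ?_⟩
    · have : ⇑(∑ i, ‖T i‖₊ • q.comp (dd (b i)).toLinearMap) =
          fun f => ∑ i, ‖T i‖ * q (dd (b i) f) := by
        ext f
        rw [seminorm_sum_apply]
        rfl
      rw [this]
      exact continuous_finsetSum _ fun i _ => continuous_const.mul (hq.comp (dd (b i)).continuous)
    · have e : (∑ i, ‖T i‖₊ • q.comp (dd (b i)).toLinearMap) f =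
          ∑ i, ‖T i‖ * q (dd (b i) f) := by
        rw [seminorm_sum_apply]
        rfl
      rw [e, ← norm_iteratedFDeriv_fderiv, hA]
      have hcd' (i) : ContDiff ℝ n (T i ∘ A (dd (b i) f)) :=
        (T i).contDiff.comp ((hcd _).of_le (mod_cast le_top))
      rw [iteratedFDeriv_fun_sum_apply (fun i _ => (hcd' i).contDiffAt)]
      calc _ ≤ ‖x‖ ^ k * ∑ i, ‖iteratedFDeriv ℝ n (T i ∘ A (dd (b i) f)) x‖ := by
            gcongr
            exact norm_sum_le _ _
        _ ≤ ‖x‖ ^ k * ∑ i, ‖T i‖ * ‖iteratedFDeriv ℝ n (A (dd (b i) f)) x‖ := by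
            gcongr with i
            exact (T i).norm_iteratedFDeriv_comp_left ((hcd _).contDiffAt) (mod_cast le_top)
        _ = ∑ i, ‖T i‖ * (‖x‖ ^ k * ‖iteratedFDeriv ℝ n (A (dd (b i) f)) x‖) := by
            rw [Finset.mul_sum]
            exact Finset.sum_congr rfl fun i _ => by ring
        _ ≤ _ := by
            gcongr with i
            exact H _ _

/-- A continuous linear map between Schwartz spaces, given pointwise by `A`: it is enough that the
derivative of `A f` in direction `h` is `A (dd h f)`, and that `A f` decays rapidly. -/
def ofDeriv (A : 𝓢(D, ℂ) → X → ℂ) (dd : X → 𝓢(D, ℂ) →L[ℂ] 𝓢(D, ℂ))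
    (hadd : ∀ f g x, A (f + g) x = A f x + A g x)
    (hsmul : ∀ (a : ℂ) f x, A (a • f) x = a • A f x)
    (hder : ∀ f x, ∃ L : X →L[ℝ] ℂ, HasFDerivAt (A f) L x ∧ ∀ h, L h = A (dd h f) x)
    (h0 : ∀ k : ℕ, ∃ q : Seminorm ℂ 𝓢(D, ℂ), Continuous q ∧ ∀ f x, ‖x‖ ^ k * ‖A f x‖ ≤ q f) :
    𝓢(D, ℂ) →L[ℂ] 𝓢(X, ℂ) :=
  SchwartzMap.mkCLM A hadd hsmul (contDiff_of_deriv A dd hder) (by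
    rintro ⟨k, n⟩
    obtain ⟨q, hq, H⟩ := bound_of_deriv A dd hder k (h0 k) n
    obtain ⟨s, C, -, hC⟩ := Seminorm.bound_of_continuous (schwartz_withSeminorms ℂ D ℂ) q hq
    exact ⟨s, C, C.2, fun f x => (H f x).trans (hC f)⟩)

end Construction

section PartialMaps

variable {E F : Type} [NormedAddCommGroup E] [NormedSpace ℝ E]
  [NormedAddCommGroup F] [NormedSpace ℝ F]

/-- A property of pairs of seminorms that holds for the Schwartz seminorms on the left
holds for all continuous seminorms. -/
theorem exists_seminorm {G : Type} [NormedAddCommGroup G] [NormedSpace ℝ G]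
    {ι : Type} (a : ι → 𝓢(F, ℂ)) (c : ι → ℝ) (hc : ∀ i, 0 ≤ c i) (g : ι → 𝓢(G, ℂ))
    (H : ∀ j n, ∃ q : Seminorm ℝ 𝓢(G, ℂ), Continuous q ∧ ∀ i t,
      ‖t‖ ^ j * ‖iteratedFDeriv ℝ n (a i) t‖ ≤ c i * q (g i))
    (p : Seminorm ℂ 𝓢(F, ℂ)) (hp : Continuous p) :
    ∃ q : Seminorm ℂ 𝓢(G, ℂ), Continuous q ∧ ∀ i, p (a i) ≤ c i * q (g i) := by
  obtain ⟨s, C, -, hC⟩ := Seminorm.bound_of_continuous (schwartz_withSeminorms ℂ F ℂ) p hp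
  have hs : ∃ q : Seminorm ℂ 𝓢(G, ℂ), Continuous q ∧
      ∀ i, s.sup (schwartzSeminormFamily ℂ F ℂ) (a i) ≤ c i * q (g i) := by
    clear hC
    induction s using Finset.induction_on with
    | empty => exact ⟨0, continuous_const, fun i => by simp⟩
    | insert m s _ ih =>
      obtain ⟨q, hq, h⟩ := ih
      obtain ⟨q₁, hq₁, h₁⟩ := H m.1 m.2
      obtain ⟨s', C', -, hC'⟩ :=
        Seminorm.bound_of_continuous (schwartz_withSeminorms ℝ G ℂ) q₁ hq₁
      refine ⟨q + C' • ∑ m ∈ s', schwartzSeminormFamily ℂ G ℂ m, ?_, fun i => ?_⟩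
      · have : ⇑(q + C' • ∑ m ∈ s', schwartzSeminormFamily ℂ G ℂ m) =
            fun f => q f + C' * ∑ m ∈ s', schwartzSeminormFamily ℂ G ℂ m f := by
          ext f
          rw [← seminorm_sum_apply]
          rfl
        rw [this]
        exact hq.add (continuous_const.mul (continuous_finsetSum _ fun m _ =>
          (schwartz_withSeminorms ℂ G ℂ).continuous_seminorm m))
      · have e : (q + C' • ∑ m ∈ s', schwartzSeminormFamily ℂ G ℂ m) (g i) =
            q (g i) + C' * ∑ m ∈ s', schwartzSeminormFamily ℂ G ℂ m (g i) := by
          rw [← seminorm_sum_apply]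
          rfl
        have hq0 : 0 ≤ q (g i) := apply_nonneg _ _
        have hsum0 : 0 ≤ C' * ∑ m ∈ s', schwartzSeminormFamily ℂ G ℂ m (g i) :=
          mul_nonneg C'.2 (Finset.sum_nonneg fun m _ => apply_nonneg _ _)
        have hq₁' : q₁ (g i) ≤ C' * ∑ m ∈ s', schwartzSeminormFamily ℂ G ℂ m (g i) := by
          refine (hC' (g i)).trans ?_
          change (C' : ℝ) * _ ≤ _
          gcongr
          have := Seminorm.finset_sup_le_sum (schwartzSeminormFamily ℝ G ℂ) s' (g i)
          rw [seminorm_sum_apply] at this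
          exact this
        rw [Finset.sup_insert, e]
        refine sup_le ?_ ?_
        · refine (SchwartzMap.seminorm_le_bound ℂ m.1 m.2 (a i)
            (mul_nonneg (hc i) (apply_nonneg q₁ _)) (h₁ i)).trans ?_
          exact mul_le_mul_of_nonneg_left (by linarith) (hc i)
        · exact (h i).trans (mul_le_mul_of_nonneg_left (by linarith) (hc i))
  obtain ⟨q, hq, h⟩ := hs
  refine ⟨C • q, continuous_const.mul hq, fun i => (hC (a i)).trans ?_⟩
  change (C : ℝ) * _ ≤ c i * (C * q (g i))
  calc (C : ℝ) * _ ≤ C * (c i * q (g i)) := by gcongr; exact h i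
    _ = _ := by ring


theorem slice_decay (k : ℕ) (p : Seminorm ℂ 𝓢(F, ℂ)) (hp : Continuous p) :
    ∃ q : Seminorm ℂ 𝓢(E × F, ℂ), Continuous q ∧
      ∀ (f : 𝓢(E × F, ℂ)) (x : E), ‖x‖ ^ k * p (slice ℂ x f) ≤ q f := by
  obtain ⟨q, hq, H⟩ := exists_seminorm (ι := 𝓢(E × F, ℂ) × E)
    (fun i => (‖i.2‖ ^ k) • slice ℂ i.2 i.1) (fun _ => 1) (fun _ => zero_le_one) (fun i => i.1)
    (fun j n => by
      obtain ⟨q, hq, H⟩ := partial_decay (E := E) (F := F) k j n ℂ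
      refine ⟨q, hq, fun i t => ?_⟩
      have e : ⇑((‖i.2‖ ^ k) • slice ℂ i.2 i.1) = (‖i.2‖ ^ k) • fun t => i.1 (i.2, t) := rfl
      have hc : ContDiffAt ℝ n (fun t => i.1 (i.2, t)) t := (slice ℂ i.2 i.1).contDiffAt n
      rw [e, iteratedFDeriv_const_smul_apply hc, norm_smul, one_mul, norm_pow, norm_norm]
      refine le_trans (le_of_eq ?_) (H i.1 i.2 t)
      ring) p hp
  refine ⟨q, hq, fun f x => ?_⟩
  have := H (f, x)
  have e : p ((‖x‖ ^ k) • slice ℂ x f) = ‖x‖ ^ k * p (slice ℂ x f) := by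
    have e1 : (‖x‖ ^ k) • slice ℂ x f = ((‖x‖ ^ k : ℝ) : ℂ) • slice ℂ x f := rfl
    rw [e1, map_smul_eq_mul, Complex.norm_real, norm_pow, norm_norm]
  simp only [one_mul] at this
  rw [← e]
  exact this

theorem slice_taylor (p : Seminorm ℂ 𝓢(F, ℂ)) (hp : Continuous p) :
    ∃ q : Seminorm ℂ 𝓢(E × F, ℂ), Continuous q ∧ ∀ (f : 𝓢(E × F, ℂ)) (x h : E),
      p (slice ℂ (x + h) f - slice ℂ x f - slice ℂ x (∂_{(h, (0 : F))} f)) ≤ ‖h‖ ^ 2 * q f := by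
  obtain ⟨q, hq, H⟩ := exists_seminorm (ι := 𝓢(E × F, ℂ) × E × E)
    (fun i => slice ℂ (i.2.1 + i.2.2) i.1 - slice ℂ i.2.1 i.1
      - slice ℂ i.2.1 (∂_{(i.2.2, (0 : F))} i.1))
    (fun i => ‖i.2.2‖ ^ 2) (fun _ => by positivity) (fun i => i.1)
    (fun j n => by
      obtain ⟨q, hq, H⟩ := partial_taylor (E := E) (F := F) j n ℂ
      exact ⟨q, hq, fun i t => H i.1 i.2.1 i.2.2 t⟩) p hp
  exact ⟨q, hq, fun f x h => H (f, x, h)⟩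

theorem slice_lineDeriv_bound (p : Seminorm ℂ 𝓢(F, ℂ)) (hp : Continuous p) :
    ∃ q : Seminorm ℂ 𝓢(E × F, ℂ), Continuous q ∧ ∀ (f : 𝓢(E × F, ℂ)) (x h : E),
      p (slice ℂ x (∂_{(h, (0 : F))} f)) ≤ ‖h‖ * q f := by
  obtain ⟨q₀, hq₀, H₀⟩ := slice_decay (E := E) 0 p hp
  obtain ⟨q, hq, H⟩ := exists_seminorm (ι := 𝓢(E × F, ℂ) × E)
    (fun i => ∂_{(i.2, (0 : F))} i.1) (fun i => ‖i.2‖) (fun _ => norm_nonneg _) (fun i => i.1)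
    (fun j n => by
      refine ⟨SchwartzMap.seminorm ℝ j (n + 1),
        (schwartz_withSeminorms ℝ (E × F) ℂ).continuous_seminorm (j, n + 1), fun i t => ?_⟩
      have e : ⇑(∂_{(i.2, (0 : F))} i.1 : 𝓢(E × F, ℂ)) = fun z => fderiv ℝ i.1 z (i.2, 0) := by
        ext z; exact SchwartzMap.lineDerivOp_apply_eq_fderiv _ _ _
      rw [e]
      have h1 : ‖iteratedFDeriv ℝ n (fun z => fderiv ℝ i.1 z (i.2, (0 : F))) t‖ ≤
          ‖i.2‖ * ‖iteratedFDeriv ℝ (n + 1) i.1 t‖ := by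
        rw [← norm_iteratedFDeriv_fderiv]
        have := norm_iteratedFDeriv_clm_apply_const (n := n) (N := n) (c := (i.2, (0 : F)))
          ((SchwartzMap.fderivCLM ℝ (E × F) ℂ i.1).contDiffAt n (x := t)) le_rfl
        have hn : ‖((i.2, (0 : F)) : E × F)‖ = ‖i.2‖ := by simp [Prod.norm_def]
        rw [hn] at this
        exact this
      calc _ ≤ ‖t‖ ^ j * (‖i.2‖ * ‖iteratedFDeriv ℝ (n + 1) i.1 t‖) := by gcongr
        _ = ‖i.2‖ * (‖t‖ ^ j * ‖iteratedFDeriv ℝ (n + 1) i.1 t‖) := by ring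
        _ ≤ _ := by
          gcongr
          exact SchwartzMap.le_seminorm ℝ j (n + 1) i.1 t) q₀ hq₀
  refine ⟨q, hq, fun f x h => ?_⟩
  have h1 := H₀ (∂_{(h, (0 : F))} f) x
  rw [pow_zero, one_mul] at h1
  exact h1.trans (H (f, h))

variable [FiniteDimensional ℝ E]

/-- The derivative of `x ↦ ν (f (x, ·))`. -/
def sliceDeriv (ν : 𝓢(F, ℂ) →L[ℂ] ℂ) (f : 𝓢(E × F, ℂ)) (x : E) : E →L[ℝ] ℂ :=
  LinearMap.toContinuousLinearMap
    { toFun := fun h => ν (slice ℂ x (∂_{(h, (0 : F))} f))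
      map_add' := fun h h' => by
        have : ((h + h', (0 : F)) : E × F) = (h, 0) + (h', 0) := by simp
        rw [this, LineDeriv.lineDerivOp_left_add, map_add, map_add]
      map_smul' := fun c h => by
        have : ((c • h, (0 : F)) : E × F) = c • (h, 0) := by simp
        rw [this, LineDeriv.lineDerivOp_left_smul, RingHom.id_apply]
        have e : c • (∂_{(h, (0 : F))} f : 𝓢(E × F, ℂ)) = (c : ℂ) • ∂_{(h, (0 : F))} f := rfl
        rw [e, map_smul, map_smul]
        rfl }

theorem sliceDeriv_apply (ν : 𝓢(F, ℂ) →L[ℂ] ℂ) (f : 𝓢(E × F, ℂ)) (x h : E) :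
    sliceDeriv ν f x h = ν (slice ℂ x (∂_{(h, (0 : F))} f)) := rfl

theorem hasFDerivAt_slice (ν : 𝓢(F, ℂ) →L[ℂ] ℂ) (f : 𝓢(E × F, ℂ)) (x : E) :
    HasFDerivAt (fun x => ν (slice ℂ x f)) (sliceDeriv ν f x) x := by
  obtain ⟨q, -, H⟩ := slice_taylor (E := E) ((normSeminorm ℂ ℂ).comp ν.toLinearMap)
    (continuous_norm.comp ν.continuous)
  rw [hasFDerivAt_iff_isLittleO_nhds_zero]
  refine Asymptotics.IsBigO.trans_isLittleO (g := fun h : E => ‖h‖ ^ 2) ?_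
    (Asymptotics.isLittleO_norm_pow_id one_lt_two)
  refine Asymptotics.IsBigO.of_bound (q f) (Eventually.of_forall fun h => ?_)
  have := H f x h
  rw [Seminorm.comp_apply] at this
  change ‖ν _‖ ≤ _ at this
  rw [map_sub, map_sub] at this
  rw [sliceDeriv_apply, norm_pow, norm_norm, mul_comm]
  exact this

/-- For a tempered distribution `ν` in the variable `t`, the Schwartz function
`x ↦ ν (f (x, ·))`. -/
def partialPairing (ν : 𝓢(F, ℂ) →L[ℂ] ℂ) : 𝓢(E × F, ℂ) →L[ℂ] 𝓢(E, ℂ) :=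
  ofDeriv (fun f x => ν (slice ℂ x f))
    (fun h => LineDeriv.lineDerivOpCLM ℂ 𝓢(E × F, ℂ) (h, (0 : F)))
    (fun f g x => by rw [map_add, map_add]) (fun a f x => by rw [map_smul, map_smul])
    (fun f x => ⟨sliceDeriv ν f x, hasFDerivAt_slice ν f x, fun h => rfl⟩)
    (fun k => slice_decay k ((normSeminorm ℂ ℂ).comp ν.toLinearMap)
      (continuous_norm.comp ν.continuous))

theorem partialPairing_apply (ν : 𝓢(F, ℂ) →L[ℂ] ℂ) (f : 𝓢(E × F, ℂ)) (x : E) :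
    partialPairing ν f x = ν (slice ℂ x f) := rfl

end PartialMaps

section PartialFourier

variable {E F : Type} [NormedAddCommGroup E] [NormedSpace ℝ E]
  [NormedAddCommGroup F] [InnerProductSpace ℝ F] [FiniteDimensional ℝ F]
  [MeasurableSpace F] [BorelSpace F]

/-- The operator on Schwartz functions which corresponds, under the Fourier transform in the second
variable, to the derivative in direction `h`. -/
def fourierDeriv (h : E × F) : 𝓢(E × F, ℂ) →L[ℂ] 𝓢(E × F, ℂ) :=
  LineDeriv.lineDerivOpCLM ℂ 𝓢(E × F, ℂ) (h.1, (0 : F)) +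
    (-(2 * Real.pi * Complex.I)) • SchwartzMap.smulLeftCLM ℂ (fun z : E × F => ((inner ℝ z.2 h.2 : ℝ) : ℂ))

theorem fourier_slice_fourierDeriv (f : 𝓢(E × F, ℂ)) (z h : E × F) :
    (𝓕 (slice ℂ z.1 (fourierDeriv h f)) : 𝓢(F, ℂ)) z.2 =
      (𝓕 (slice ℂ z.1 (∂_{(h.1, (0 : F))} f)) : 𝓢(F, ℂ)) z.2 +
        fderiv ℝ (𝓕 (slice ℂ z.1 f) : 𝓢(F, ℂ)) z.2 h.2 := by
  have e : slice ℂ z.1 (fourierDeriv h f) = slice ℂ z.1 (∂_{(h.1, (0 : F))} f) +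
      (-(2 * Real.pi * Complex.I)) • SchwartzMap.smulLeftCLM ℂ (fun t : F => inner ℝ t h.2)
        (slice ℂ z.1 f) := by
    ext t
    have h1 : (fun z : E × F =>
        ((inner ℝ (ContinuousLinearMap.snd ℝ E F z) h.2 : ℝ) : ℂ)).HasTemperateGrowth := by
      fun_prop
    change (∂_{(h.1, (0 : F))} f + (-(2 * Real.pi * Complex.I)) • SchwartzMap.smulLeftCLM ℂ
      (fun z : E × F => ((inner ℝ (ContinuousLinearMap.snd ℝ E F z) h.2 : ℝ) : ℂ)) f) (z.1, t) = _
    have h2 : (fun t : F => inner ℝ t h.2).HasTemperateGrowth := by fun_prop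
    have h3 := SchwartzMap.smulLeftCLM_apply_apply h1 f (z.1, t)
    rw [add_apply, smul_apply, h3]
    simp [SchwartzMap.smulLeftCLM_apply_apply h2]
  rw [e, FourierTransform.fourier_add, ← SchwartzMap.lineDerivOp_fourier_eq,
    ← SchwartzMap.lineDerivOp_apply_eq_fderiv h.2 (𝓕 (slice ℂ z.1 f) : 𝓢(F, ℂ)) z.2]
  rfl

theorem fourier_slice_decay (k : ℕ) : ∃ q : Seminorm ℂ 𝓢(E × F, ℂ), Continuous q ∧
    ∀ (f : 𝓢(E × F, ℂ)) (z : E × F), ‖z‖ ^ k * ‖(𝓕 (slice ℂ z.1 f) : 𝓢(F, ℂ)) z.2‖ ≤ q f := by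
  have hex (j : ℕ) : ∃ p : Seminorm ℂ 𝓢(F, ℂ), Continuous p ∧
      ∀ (g : 𝓢(F, ℂ)) (t : F), ‖t‖ ^ j * ‖(𝓕 g : 𝓢(F, ℂ)) t‖ ≤ p g := by
    let p : Seminorm ℂ 𝓢(F, ℂ) := (SchwartzMap.seminorm ℂ j 0).comp
      (FourierTransform.fourierCLM ℂ 𝓢(F, ℂ)).toLinearMap
    have hp : Continuous p := ((schwartz_withSeminorms ℂ F ℂ).continuous_seminorm (j, 0)).comp
      (FourierTransform.fourierCLM ℂ 𝓢(F, ℂ)).continuous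
    exact ⟨p, hp, fun g t => SchwartzMap.norm_pow_mul_le_seminorm ℂ (𝓕 g : 𝓢(F, ℂ)) j t⟩
  obtain ⟨p, hp, H⟩ := hex 0
  obtain ⟨p', hp', H'⟩ := hex k
  obtain ⟨q, hq, K⟩ := slice_decay (E := E) k p hp
  obtain ⟨q', hq', K'⟩ := slice_decay (E := E) 0 p' hp'
  refine ⟨q + q', hq.add hq', fun f z => ?_⟩
  have h1 : ‖z.1‖ ^ k * ‖(𝓕 (slice ℂ z.1 f) : 𝓢(F, ℂ)) z.2‖ ≤ q f := by
    refine le_trans ?_ (K f z.1)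
    gcongr
    simpa using H (slice ℂ z.1 f) z.2
  have h2 : ‖z.2‖ ^ k * ‖(𝓕 (slice ℂ z.1 f) : 𝓢(F, ℂ)) z.2‖ ≤ q' f := by
    refine (H' (slice ℂ z.1 f) z.2).trans ?_
    simpa using K' f z.1
  have hq0 : 0 ≤ q f := apply_nonneg _ _
  have hq'0 : 0 ≤ q' f := apply_nonneg _ _
  change _ ≤ q f + q' f
  rcases max_choice ‖z.1‖ ‖z.2‖ with h | h <;> rw [Prod.norm_def, h] <;> linarith

variable [FiniteDimensional ℝ E]

theorem hasFDerivAt_fourier_slice (f : 𝓢(E × F, ℂ)) (z : E × F) :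
    ∃ L : E × F →L[ℝ] ℂ, HasFDerivAt (fun z : E × F => (𝓕 (slice ℂ z.1 f) : 𝓢(F, ℂ)) z.2) L z ∧
      ∀ h, L h = (𝓕 (slice ℂ z.1 (fourierDeriv h f)) : 𝓢(F, ℂ)) z.2 := by
  let ev (w : F) : 𝓢(F, ℂ) →L[ℂ] ℂ :=
    (TemperedDistribution.delta w : 𝓢(F, ℂ) →L[ℂ] ℂ).comp (FourierTransform.fourierCLM ℂ 𝓢(F, ℂ))
  let p : Seminorm ℂ 𝓢(F, ℂ) := (SchwartzMap.seminorm ℂ 0 0).comp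
    (FourierTransform.fourierCLM ℂ 𝓢(F, ℂ)).toLinearMap
  have hp : Continuous p := ((schwartz_withSeminorms ℂ F ℂ).continuous_seminorm (0, 0)).comp
    (FourierTransform.fourierCLM ℂ 𝓢(F, ℂ)).continuous
  let p' : Seminorm ℂ 𝓢(F, ℂ) := (SchwartzMap.seminorm ℂ 0 1).comp
    (FourierTransform.fourierCLM ℂ 𝓢(F, ℂ)).toLinearMap
  have hp' : Continuous p' := ((schwartz_withSeminorms ℂ F ℂ).continuous_seminorm (0, 1)).comp
    (FourierTransform.fourierCLM ℂ 𝓢(F, ℂ)).continuous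
  obtain ⟨q, -, Hq⟩ := slice_taylor (E := E) p hp
  obtain ⟨q', -, Hq'⟩ := slice_lineDeriv_bound (E := E) p' hp'
  refine ⟨(sliceDeriv (ev z.2) f z.1).comp (ContinuousLinearMap.fst ℝ E F) +
    (fderiv ℝ (𝓕 (slice ℂ z.1 f) : 𝓢(F, ℂ)) z.2).comp (ContinuousLinearMap.snd ℝ E F), ?_, fun h => ?_⟩
  swap
  · rw [fourier_slice_fourierDeriv]; rfl
  rw [hasFDerivAt_iff_isLittleO_nhds_zero]
  let g : 𝓢(F, ℂ) := 𝓕 (slice ℂ z.1 f)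
  have h3 : (fun h : E × F => g (z.2 + h.2) - g z.2 - fderiv ℝ g z.2 h.2) =o[𝓝 0]
      fun h : E × F => h := by
    have := (g.hasFDerivAt z.2)
    rw [hasFDerivAt_iff_isLittleO_nhds_zero] at this
    have ht : Tendsto (fun h : E × F => h.2) (𝓝 0) (𝓝 0) := continuous_snd.tendsto' 0 0 rfl
    refine (this.comp_tendsto ht).trans_isBigO ?_
    exact Asymptotics.IsBigO.of_bound 1 (Eventually.of_forall fun h => by
      rw [one_mul]; exact norm_snd_le h)
  have h12 : (fun h : E × F => (𝓕 (slice ℂ (z.1 + h.1) f) : 𝓢(F, ℂ)) (z.2 + h.2) - g (z.2 + h.2)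
      - (𝓕 (slice ℂ z.1 (∂_{(h.1, (0 : F))} f)) : 𝓢(F, ℂ)) z.2) =o[𝓝 0] fun h : E × F => h := by
    refine Asymptotics.IsBigO.trans_isLittleO (g := fun h : E × F => ‖h‖ ^ 2) ?_
      (Asymptotics.isLittleO_norm_pow_id one_lt_two)
    refine Asymptotics.IsBigO.of_bound (q f + q' f) (Eventually.of_forall fun h => ?_)
    set u : 𝓢(F, ℂ) := 𝓕 (slice ℂ z.1 (∂_{(h.1, (0 : F))} f)) with hu
    have b1 : ‖(𝓕 (slice ℂ (z.1 + h.1) f) : 𝓢(F, ℂ)) (z.2 + h.2) - g (z.2 + h.2) - u (z.2 + h.2)‖ ≤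
        ‖h.1‖ ^ 2 * q f := by
      refine le_trans ?_ (Hq f z.1 h.1)
      refine le_trans (le_of_eq ?_) (SchwartzMap.norm_le_seminorm ℂ
        (FourierTransform.fourierCLM ℂ 𝓢(F, ℂ) (slice ℂ (z.1 + h.1) f - slice ℂ z.1 f -
          slice ℂ z.1 (∂_{(h.1, (0 : F))} f))) (z.2 + h.2))
      rw [map_sub, map_sub]
      rfl
    have b2 : ‖u (z.2 + h.2) - u z.2‖ ≤ ‖h.1‖ * q' f * ‖h.2‖ := by
      have := convex_univ.norm_image_sub_le_of_norm_hasFDerivWithin_le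
        (f := u) (C := ‖h.1‖ * q' f)
        (fun y _ => (u.hasFDerivAt y).hasFDerivWithinAt) (fun y _ => ?_) (Set.mem_univ z.2)
        (Set.mem_univ (z.2 + h.2))
      · simpa using this
      · refine le_trans ?_ (Hq' f z.1 h.1)
        refine le_trans (le_of_eq ?_) (SchwartzMap.norm_iteratedFDeriv_le_seminorm ℂ u 1 y)
        rw [← norm_iteratedFDeriv_fderiv, norm_iteratedFDeriv_zero]
    have hq0 : 0 ≤ q f := apply_nonneg _ _
    have hq'0 : 0 ≤ q' f := apply_nonneg _ _
    rw [norm_pow, norm_norm]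
    calc _ = ‖((𝓕 (slice ℂ (z.1 + h.1) f) : 𝓢(F, ℂ)) (z.2 + h.2) - g (z.2 + h.2) - u (z.2 + h.2)) +
          (u (z.2 + h.2) - u z.2)‖ := by congr 1; ring
      _ ≤ ‖h.1‖ ^ 2 * q f + ‖h.1‖ * q' f * ‖h.2‖ := (norm_add_le _ _).trans (add_le_add b1 b2)
      _ ≤ ‖h‖ ^ 2 * q f + ‖h‖ * q' f * ‖h‖ := by
          gcongr
          · exact norm_fst_le h
          · exact norm_fst_le h
          · exact norm_snd_le h
      _ = _ := by ring
  refine (h12.add h3).congr_left fun h => ?_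
  change _ = _ - _ - ((𝓕 (slice ℂ z.1 (∂_{(h.1, (0 : F))} f)) : 𝓢(F, ℂ)) z.2 + fderiv ℝ g z.2 h.2)
  simp only [Prod.fst_add, Prod.snd_add, g]
  ring

/-- The partial Fourier transform `(x, w) ↦ ∫ f (x, t) e ^ (-2 π i ⟨t, w⟩) dt` of Schwartz
functions. -/
def partialFourier : 𝓢(E × F, ℂ) →L[ℂ] 𝓢(E × F, ℂ) :=
  ofDeriv (fun f z => (𝓕 (slice ℂ z.1 f) : 𝓢(F, ℂ)) z.2) fourierDeriv
    (fun f g z => by rw [map_add, FourierTransform.fourier_add]; rfl)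
    (fun a f z => by rw [map_smul, FourierTransform.fourier_smul]; rfl)
    hasFDerivAt_fourier_slice fourier_slice_decay

theorem partialFourier_apply (f : 𝓢(E × F, ℂ)) (x : E) (w : F) :
    partialFourier f (x, w) =
      ∫ t, Complex.exp (-2 * Real.pi * Complex.I * inner ℝ t w) * f (x, t) := by
  change 𝓕 (fun t => f (x, t)) w = _
  rw [Real.fourier_eq']
  congr 1
  ext t
  rw [smul_eq_mul]
  congr 2
  push_cast
  ring

end PartialFourier

section Distributions

variable {E F : Type} [NormedAddCommGroup E] [NormedSpace ℝ E]

/-- The tensor product of tempered distributions: `(μ ⊗ ν) f = μ (x ↦ ν (f (x, ·)))`. -/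
def tensor [FiniteDimensional ℝ E] [NormedAddCommGroup F] [NormedSpace ℝ F] (μ : 𝓢'(E, ℂ)) (ν : 𝓢'(F, ℂ)) :
    𝓢'(E × F, ℂ) :=
  PointwiseConvergenceCLM.precomp ℂ (partialPairing ν) μ

/-- Complex conjugation of Schwartz functions. -/
def conjSchwartz : 𝓢(E, ℂ) →SL[starRingEnd ℂ] 𝓢(E, ℂ) :=
  SchwartzMap.mkCLM (fun f x => starRingEnd ℂ (f x)) (fun f g x => by simp) (fun a f x => by simp)
    (fun f => Complex.conjCLE.contDiff.comp (f.smooth ⊤)) (by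
      rintro ⟨k, n⟩
      refine ⟨{(k, n)}, 1, zero_le_one, fun f x => ?_⟩
      have := Complex.conjLIE.norm_iteratedFDeriv_comp_left (f : E → ℂ) x n
      change ‖iteratedFDeriv ℝ n (fun x => starRingEnd ℂ (f x)) x‖ = _ at this
      simp only [this, Finset.sup_singleton, one_mul]
      exact SchwartzMap.le_seminorm ℂ k n f x)

/-- The complex conjugate `f ↦ conj (μ (conj f))` of a tempered distribution. -/
def conjDistribution (μ : 𝓢'(E, ℂ)) : 𝓢'(E, ℂ) :=
  ContinuousLinearMap.toPointwiseConvergenceCLM ℂ (RingHom.id ℂ) 𝓢(E, ℂ) ℂ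
    ({ toFun := fun f => starRingEnd ℂ (μ (conjSchwartz f))
       map_add' := fun f g => by simp
       map_smul' := fun a f => by simp
       cont := Complex.continuous_conj.comp (μ.continuous.comp conjSchwartz.continuous) } :
      𝓢(E, ℂ) →L[ℂ] ℂ)

/-- The linear change of variables `P_M` on tempered distributions, which extends
`Φ ↦ Φ ∘ M` on functions: `⟨P_M Ψ, φ⟩ = |det M|⁻¹ ⟨Ψ, φ ∘ M⁻¹⟩`. -/
def changeOfVar (M : E ≃L[ℝ] E) (Ψ : 𝓢'(E, ℂ)) : 𝓢'(E, ℂ) :=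
  ((|LinearMap.det (M : E →ₗ[ℝ] E)|⁻¹ : ℝ) : ℂ) •
    PointwiseConvergenceCLM.precomp ℂ (SchwartzMap.compCLMOfContinuousLinearEquiv ℂ M.symm) Ψ

/-- The partial Fourier transform in the second variable on tempered distributions:
`⟨𝓕₂ Ψ, φ⟩ = ⟨Ψ, 𝓕₂ φ⟩`. -/
def partialFourierDistribution [FiniteDimensional ℝ E] [NormedAddCommGroup F] [InnerProductSpace ℝ F]
    [FiniteDimensional ℝ F] [MeasurableSpace F] [BorelSpace F] (Ψ : 𝓢'(E × F, ℂ)) :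
    𝓢'(E × F, ℂ) :=
  PointwiseConvergenceCLM.precomp ℂ partialFourier Ψ

end Distributions

section Wigner

variable {d : ℕ}

/-- The invertible linear map `(x, t) ↦ (A₀ x + B₀ t, C₀ x + D₀ t)` of `ℝᵈ × ℝᵈ` given by an
invertible matrix with blocks `A₀, B₀, C₀, D₀`. -/
def blockEquiv (T : Matrix (Fin d ⊕ Fin d) (Fin d ⊕ Fin d) ℝ) (hT : IsUnit T.det) :
    (EuclideanSpace ℝ (Fin d) × EuclideanSpace ℝ (Fin d)) ≃L[ℝ]
      (EuclideanSpace ℝ (Fin d) × EuclideanSpace ℝ (Fin d)) :=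
  (Matrix.toLinearEquiv ((EuclideanSpace.basisFun (Fin d) ℝ).toBasis.prod
    (EuclideanSpace.basisFun (Fin d) ℝ).toBasis) T hT).toContinuousLinearEquiv

theorem blockEquiv_apply (A B C D : Matrix (Fin d) (Fin d) ℝ)
    (hT : IsUnit (Matrix.fromBlocks A B C D).det) (x t : EuclideanSpace ℝ (Fin d)) :
    blockEquiv (Matrix.fromBlocks A B C D) hT (x, t) =
      (Matrix.toEuclideanLin A x + Matrix.toEuclideanLin B t,
        Matrix.toEuclideanLin C x + Matrix.toEuclideanLin D t) := by
  have e : blockEquiv (Matrix.fromBlocks A B C D) hT (x, t) =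
      Matrix.toLin ((EuclideanSpace.basisFun (Fin d) ℝ).toBasis.prod
        (EuclideanSpace.basisFun (Fin d) ℝ).toBasis)
        ((EuclideanSpace.basisFun (Fin d) ℝ).toBasis.prod
        (EuclideanSpace.basisFun (Fin d) ℝ).toBasis) (Matrix.fromBlocks A B C D) (x, t) := rfl
  rw [e, Matrix.toLin_apply]
  ext i <;>
  simp [Matrix.mulVec, dotProduct, Matrix.toEuclideanLin, Fintype.sum_sum_type, Finset.sum_apply,
    Prod.fst_sum, Prod.snd_sum, Pi.single_apply]

/-- The matrix-Wigner transform `W_T(μ) = 𝓕₂ (P_T (μ ⊗ μ̄))` of a tempered distribution. -/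
def matrixWigner (T : Matrix (Fin d ⊕ Fin d) (Fin d ⊕ Fin d) ℝ) (hT : IsUnit T.det)
    (μ : 𝓢'(EuclideanSpace ℝ (Fin d), ℂ)) :
    𝓢'(EuclideanSpace ℝ (Fin d) × EuclideanSpace ℝ (Fin d), ℂ) :=
  partialFourierDistribution (changeOfVar (blockEquiv T hT) (tensor μ (conjDistribution μ)))

theorem isUnit_det_fromBlocks {A₀ C₀ : Matrix (Fin d) (Fin d) ℝ} (h : (A₀ - C₀).det ≠ 0) :
    IsUnit (Matrix.fromBlocks A₀ 1 C₀ 1).det := by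
  rw [Matrix.det_fromBlocks_one₂₂, Matrix.one_mul]
  exact h.isUnit

theorem det_half_sub (d : ℕ) :
    ((1 / 2 : ℝ) • (1 : Matrix (Fin d) (Fin d) ℝ) - (-(1 / 2) : ℝ) • 1).det ≠ 0 := by
  rw [← sub_smul]
  norm_num

/-- The ambiguity function of a tempered distribution: the matrix-Wigner transform whose matrix
has the blocks `Id / 2, Id, -Id / 2, Id`. -/
def ambiguity (μ : 𝓢'(EuclideanSpace ℝ (Fin d), ℂ)) :
    𝓢'(EuclideanSpace ℝ (Fin d) × EuclideanSpace ℝ (Fin d), ℂ) :=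
  matrixWigner (Matrix.fromBlocks ((1 / 2 : ℝ) • 1) 1 ((-(1 / 2) : ℝ) • 1) 1)
    (isUnit_det_fromBlocks (det_half_sub d)) μ

end Wigner

/-- A discrete set is a set without accumulation points in the ambient space. -/
def IsDiscreteSet {X : Type} [TopologicalSpace X] (S : Set X) : Prop :=
  ∀ x : X, ¬ AccPt x (𝓟 S)

/-- A set is uniformly discrete if its distinct points have mutual distance at least some `δ > 0`. -/
def IsUniformlyDiscrete {X : Type} [PseudoMetricSpace X] (S : Set X) : Prop :=
  ∃ δ : ℝ, 0 < δ ∧ ∀ r ∈ S, ∀ s ∈ S, s ≠ r → δ ≤ dist r s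

end MatrixWigner
end

namespace MatrixWigner

open Distribution

/-! ### Localisation of tempered distributions away from their support -/

section Support

variable {E : Type} [NormedAddCommGroup E] [NormedSpace ℝ E]

/-! Since both right-hand blocks are the identity, the two components of `T (x, t)` differ by `L x`,
where `L = A₀ - C₀`, whatever `t` is. The change of variables therefore turns the band `{z | z.1 -
z.2 ∈ D}` into the cylinder `(L ⁻¹' D) ×ˢ univ`. The partial Fourier transform acts on each slice `x
= const` separately and is invertible, so it preserves vanishing on cylinders over closed sets.
Hence the transform vanishes on such a cylinder iff `μ ⊗ μ̄` vanishes on the band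
(`isVanishingOn_partialFourier_changeOfVar_iff`).

Conjugation keeps the support, and the support of the tensor product is governed by the product of
the supports (`prod_subset_dsupport_tensor`, `isVanishingOn_tensor_of_sub_mem`). So the projected
support and `L ⁻¹' (supp μ - supp μ)` each lie in the closure of the other. Discrete sets are
closed, and so are their subsets, which removes both closures. Uniform discreteness only needs that
`0` is not an accumulation point of the differences.

Cylinders are unbounded, so the test functions in play are not compactly supported.
`isVanishingOn_compl_dsupport` provides for them, by a smooth cutoff dilated to infinity. -/

theorem norm_iteratedFDeriv_dilate_sub_one_le (c : 𝓢(E, ℂ)) (hc : c 0 = 1) {r : ℝ} (h0 : 0 ≤ r)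
    (h1 : r ≤ 1) (i : ℕ) (x : E) :
    ‖iteratedFDeriv ℝ i (fun x => c (r • x) - 1) x‖ ≤
      r * SchwartzMap.seminorm ℝ 0 (max i 1) c * (1 + ‖x‖) := by
  have hx : 0 ≤ ‖x‖ := norm_nonneg x
  -- Order zero uses the mean value inequality from the origin, where `c = 1`; this costs a first
  -- derivative (hence `max i 1`) and a factor `‖x‖`. In positive order the constant drops out and
  -- the chain rule yields `r ^ i ≤ r`.
  rcases Nat.eq_zero_or_pos i with rfl | hi
  · rw [norm_iteratedFDeriv_zero]
    set K := SchwartzMap.seminorm ℝ 0 (max 0 1) c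
    have hK : 0 ≤ K := apply_nonneg _ _
    have := convex_univ.norm_image_sub_le_of_norm_hasFDerivWithin_le (f := c) (C := K)
      (fun y _ => (c.hasFDerivAt y).hasFDerivWithinAt) (fun y _ => ?_) (Set.mem_univ 0)
      (Set.mem_univ (r • x))
    · rw [hc, sub_zero, norm_smul, Real.norm_of_nonneg h0] at this
      refine this.trans ?_
      have : 0 ≤ r * K := mul_nonneg h0 hK
      nlinarith
    · refine le_trans (le_of_eq ?_) (SchwartzMap.norm_iteratedFDeriv_le_seminorm ℝ c 1 y)
      rw [← norm_iteratedFDeriv_fderiv, norm_iteratedFDeriv_zero]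
  · have hd : ContDiff ℝ i (fun x => c (r • x)) :=
      ((c.smooth ⊤).of_le (mod_cast le_top)).comp (contDiff_const_smul r)
    have e : iteratedFDeriv ℝ i (fun x => c (r • x) - 1) x =
        r ^ i • iteratedFDeriv ℝ i c (r • x) := by
      rw [fun_iteratedFDeriv_sub_apply hd.contDiffAt contDiffAt_const,
        iteratedFDeriv_const_of_ne hi.ne', iteratedFDeriv_comp_const_smul]
      · simp
      · exact (c.smooth ⊤).of_le (mod_cast le_top)
    rw [e, norm_smul, norm_pow, Real.norm_of_nonneg h0, max_eq_left hi]
    have hs := SchwartzMap.norm_iteratedFDeriv_le_seminorm ℝ c i (r • x)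
    have hr : r ^ i ≤ r := pow_le_of_le_one h0 h1 hi.ne'
    have hK : 0 ≤ SchwartzMap.seminorm ℝ 0 i c := apply_nonneg _ _
    calc _ ≤ r * SchwartzMap.seminorm ℝ 0 i c * 1 := by rw [mul_one]; gcongr
      _ ≤ _ := by gcongr; linarith

/-- By the Leibniz rule every term of a seminorm of the difference carries a derivative of `c (r •
x) - 1`, hence a factor `r`. The accompanying growth `1 + ‖x‖` is absorbed by raising the weight
from `k` to `k + 1`. -/
theorem tendsto_smulLeftCLM_dilate (c : 𝓢(E, ℂ)) (hc : c 0 = 1) (u : 𝓢(E, ℂ)) :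
    Tendsto (fun r : ℝ => SchwartzMap.smulLeftCLM ℂ (fun x => c (r • x)) u) (𝓝[>] 0) (𝓝 u) := by
  rw [(schwartz_withSeminorms ℝ E ℂ).tendsto_nhds]
  rintro ⟨k, n⟩ ε hε
  let M : ℝ := ∑ i ∈ Finset.range (n + 1), (n.choose i : ℝ) *
    SchwartzMap.seminorm ℝ 0 (max i 1) c *
      (SchwartzMap.seminorm ℝ k (n - i) u + SchwartzMap.seminorm ℝ (k + 1) (n - i) u)
  have hM : 0 ≤ M := Finset.sum_nonneg fun i _ => by
    have a : 0 ≤ SchwartzMap.seminorm ℝ 0 (max i 1) c := apply_nonneg _ _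
    have b : 0 ≤ SchwartzMap.seminorm ℝ k (n - i) u := apply_nonneg _ _
    have d : 0 ≤ SchwartzMap.seminorm ℝ (k + 1) (n - i) u := apply_nonneg _ _
    positivity
  have key (r : ℝ) (h0 : 0 ≤ r) (h1 : r ≤ 1) : SchwartzMap.seminorm ℝ k n
      (SchwartzMap.smulLeftCLM ℂ (fun x => c (r • x)) u - u) ≤ r * M := by
    refine SchwartzMap.seminorm_le_bound ℝ k n _ (by positivity) fun x => ?_
    have hg : (fun x => c (r • x)).HasTemperateGrowth :=
      c.hasTemperateGrowth.comp (r • ContinuousLinearMap.id ℝ E).hasTemperateGrowth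
    have e : ⇑(SchwartzMap.smulLeftCLM ℂ (fun x => c (r • x)) u - u) =
        fun x => (c (r • x) - 1) * u x := by
      ext x
      rw [sub_apply, SchwartzMap.smulLeftCLM_apply_apply hg, smul_eq_mul]
      ring
    have hd : ContDiff ℝ n (fun x => c (r • x) - 1) :=
      (((c.smooth ⊤).of_le (mod_cast le_top)).comp (contDiff_const_smul r)).sub contDiff_const
    rw [e]
    calc _ ≤ ‖x‖ ^ k * ∑ i ∈ Finset.range (n + 1), (n.choose i : ℝ) *
          ‖iteratedFDeriv ℝ i (fun x => c (r • x) - 1) x‖ * ‖iteratedFDeriv ℝ (n - i) u x‖ := by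
          gcongr
          exact norm_iteratedFDeriv_mul_le (N := n) hd ((u.smooth ⊤).of_le (mod_cast le_top)) x le_rfl
      _ ≤ ‖x‖ ^ k * ∑ i ∈ Finset.range (n + 1), (n.choose i : ℝ) *
          (r * SchwartzMap.seminorm ℝ 0 (max i 1) c * (1 + ‖x‖)) *
            ‖iteratedFDeriv ℝ (n - i) u x‖ := by
          gcongr with i hi
          exact norm_iteratedFDeriv_dilate_sub_one_le c hc h0 h1 i x
      _ = r * ∑ i ∈ Finset.range (n + 1), (n.choose i : ℝ) *
          SchwartzMap.seminorm ℝ 0 (max i 1) c * (‖x‖ ^ k * ‖iteratedFDeriv ℝ (n - i) u x‖ +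
            ‖x‖ ^ (k + 1) * ‖iteratedFDeriv ℝ (n - i) u x‖) := by
          rw [Finset.mul_sum, Finset.mul_sum]
          exact Finset.sum_congr rfl fun i _ => by ring
      _ ≤ r * M := by
          unfold M
          gcongr with i hi
          · exact SchwartzMap.le_seminorm ℝ k (n - i) u x
          · exact SchwartzMap.le_seminorm ℝ (k + 1) (n - i) u x
  -- `M` may be zero, so the division is by `M + 1`.
  have hpos : 0 < ε / (M + 1) := by positivity
  filter_upwards [Ioo_mem_nhdsGT (lt_min one_pos hpos)] with r hr
  have hr2 := (lt_min_iff.1 hr.2)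
  refine (key r hr.1.le hr2.1.le).trans_lt ?_
  have := (lt_div_iff₀ (by positivity)).1 hr2.2
  have := hr.1
  nlinarith

variable [FiniteDimensional ℝ E]

/-- A complex valued smooth bump function as a Schwartz function. -/
theorem exists_schwartz_bump (x : E) {s : Set E} (hs : s ∈ 𝓝 x) :
    ∃ c : 𝓢(E, ℂ), HasCompactSupport c ∧ tsupport c ⊆ s ∧ ∀ᶠ y in 𝓝 x, c y = 1 := by
  obtain ⟨ε, hε, h⟩ := Metric.nhds_basis_closedBall.mem_iff.1 hs
  let b : ContDiffBump x := ⟨ε / 2, ε, by positivity, by linarith⟩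
  have hb : HasCompactSupport (Complex.ofRealCLM ∘ b) := b.hasCompactSupport.comp_left rfl
  refine ⟨hb.toSchwartzMap (Complex.ofRealCLM.contDiff.comp b.contDiff), hb, ?_, ?_⟩
  · exact (tsupport_comp_subset (g := Complex.ofRealCLM) rfl b).trans (b.tsupport_eq.trans_subset h)
  · filter_upwards [b.eventuallyEq_one] with y hy
    change ((b y : ℝ) : ℂ) = 1
    rw [hy]
    simp

variable {f : 𝓢'(E, ℂ)}

/-- Having a multiplier that equals `1` on the set and whose multiples are all killed by `f` is a
local property, stable under finite unions; compactness then does the work of a partition of unity.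
-/
theorem exists_cutoff {K : Set E} (hK : IsCompact K) (hd : Disjoint K (dsupport f)) :
    ∃ c : E → ℂ, c.HasTemperateGrowth ∧ (∀ x ∈ K, c x = 1) ∧
      ∀ u : 𝓢(E, ℂ), f (SchwartzMap.smulLeftCLM ℂ c u) = 0 := by
  refine hK.induction_on (p := fun K => ∃ c : E → ℂ, c.HasTemperateGrowth ∧ (∀ x ∈ K, c x = 1) ∧
      ∀ u : 𝓢(E, ℂ), f (SchwartzMap.smulLeftCLM ℂ c u) = 0) ?_ ?_ ?_ ?_
  · exact ⟨fun _ => 0, .const 0, by simp, fun u => by simp [SchwartzMap.smulLeftCLM_const]⟩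
  · rintro s t hst ⟨c, hc, h1, h⟩
    exact ⟨c, hc, fun x hx => h1 x (hst hx), h⟩
  · rintro s t ⟨c, hc, hc1, hcf⟩ ⟨b, hb, hb1, hbf⟩
    -- This is `1 - (1 - c) (1 - b)`, equal to `1` wherever either factor is. Each summand is a
    -- multiple of `c` or of `b`, so `f` kills all three.
    refine ⟨c + b - c * b, (hc.add hb).sub (hc.mul hb), ?_, fun u => ?_⟩
    · rintro x (hx | hx)
      · simp [hc1 x hx]
      · simp [hb1 x hx]
    · rw [SchwartzMap.smulLeftCLM_sub (hc.add hb) (hc.mul hb), SchwartzMap.smulLeftCLM_add hc hb,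
        ← SchwartzMap.smulLeftCLM_compL_smulLeftCLM hc hb, sub_apply, add_apply, map_sub, map_add,
        hcf, hbf, ContinuousLinearMap.comp_apply, hcf]
      simp
  · intro x hx
    obtain ⟨s, hs, hso, hxs⟩ := (notMem_dsupport_iff x).1 (Set.disjoint_left.1 hd hx)
    obtain ⟨c, -, hcs, hc1⟩ := exists_schwartz_bump x (hso.mem_nhds hxs)
    refine ⟨{y | c y = 1}, mem_nhdsWithin_of_mem_nhds hc1, c, c.hasTemperateGrowth,
      fun _ h => h, fun u => hs _ ?_⟩
    rw [SchwartzMap.smulLeftCLM_apply c.hasTemperateGrowth]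
    exact (tsupport_smul_subset_left _ _).trans hcs

theorem apply_eq_zero_of_hasCompactSupport {u : 𝓢(E, ℂ)} (hu : HasCompactSupport u)
    (hd : Disjoint (tsupport u) (dsupport f)) : f u = 0 := by
  obtain ⟨c, hc, hc1, hf⟩ := exists_cutoff hu hd
  rw [← hf u]
  congr 1
  ext x
  rw [SchwartzMap.smulLeftCLM_apply_apply hc]
  by_cases hx : x ∈ tsupport u
  · rw [hc1 x hx, one_smul]
  · rw [image_eq_zero_of_notMem_tsupport hx, smul_zero]

/-- A tempered distribution vanishes on the complement of its support. -/
theorem isVanishingOn_compl_dsupport (f : 𝓢'(E, ℂ)) : IsVanishingOn f (dsupport f)ᶜ := by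
  intro u hu
  -- The functions `c (r • x) u x` are compactly supported, have support inside that of `u`, and
  -- tend to `u` as `r → 0⁺`. Continuity of `f` carries the compact case over to `u`.
  obtain ⟨c, hc, -, hc1⟩ := exists_schwartz_bump (0 : E) univ_mem
  have ht := (f.continuous.tendsto u).comp (tendsto_smulLeftCLM_dilate c hc1.self_of_nhds u)
  refine tendsto_nhds_unique ht (tendsto_const_nhds.congr' ?_)
  filter_upwards [self_mem_nhdsWithin] with r (hr : 0 < r)
  have hg : (fun x => c (r • x)).HasTemperateGrowth :=
    c.hasTemperateGrowth.comp (r • ContinuousLinearMap.id ℝ E).hasTemperateGrowth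
  have e : ⇑(SchwartzMap.smulLeftCLM ℂ (fun x => c (r • x)) u) = (fun x => c (r • x)) • u :=
    SchwartzMap.smulLeftCLM_apply hg u
  refine (apply_eq_zero_of_hasCompactSupport ?_ ?_).symm
  · have hc' : HasCompactSupport (fun x => c (r • x)) :=
      hc.comp_homeomorph (Homeomorph.smulOfNeZero r hr.ne')
    rw [e]
    exact hc'.smul_right (f' := u)
  · rw [e]
    exact (Set.subset_compl_iff_disjoint_right.1 hu).mono_left
      (tsupport_smul_subset_right (fun x => c (r • x)) u)

end Support

/-! ### The partial Fourier transform and cylinders -/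

section PartialFourierSupport

variable {E F : Type} [NormedAddCommGroup E] [NormedSpace ℝ E] [FiniteDimensional ℝ E]
  [NormedAddCommGroup F] [InnerProductSpace ℝ F] [FiniteDimensional ℝ F]
  [MeasurableSpace F] [BorelSpace F]

theorem slice_partialFourier (f : 𝓢(E × F, ℂ)) (x : E) :
    slice ℂ x (partialFourier f) = 𝓕 (slice ℂ x f) := rfl

theorem partialFourier_partialFourier (f : 𝓢(E × F, ℂ)) (x : E) (w : F) :
    partialFourier (partialFourier f) (x, w) = f (x, -w) := by
  change (𝓕 (slice ℂ x (partialFourier f)) : 𝓢(F, ℂ)) w = slice ℂ x f (-w)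
  rw [slice_partialFourier]
  have h : 𝓕⁻ (𝓕 (slice ℂ x f)) = slice ℂ x f := FourierTransform.fourierInv_fourier_eq _
  rw [← congrArg (fun g : 𝓢(F, ℂ) => g (-w)) h]
  simp only [SchwartzMap.fourierInv_coe, SchwartzMap.fourier_coe]
  rw [Real.fourierInv_eq_fourier_neg, neg_neg]

/-- The square is reflection in the second variable. The cube thus serves as an inverse, and no
separate inverse operator is required. -/
theorem partialFourier_iterate_four (f : 𝓢(E × F, ℂ)) :
    partialFourier (partialFourier (partialFourier (partialFourier f))) = f := by
  ext ⟨x, w⟩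
  rw [partialFourier_partialFourier, partialFourier_partialFourier, neg_neg]

/-- Over a point outside `C` the whole slice is zero, and so is its Fourier transform; closedness of
`C` handles the closure. -/
theorem tsupport_partialFourier_subset {C : Set E} (hC : IsClosed C) {f : 𝓢(E × F, ℂ)}
    (hf : tsupport f ⊆ C ×ˢ Set.univ) : tsupport (partialFourier f) ⊆ C ×ˢ Set.univ := by
  refine closure_minimal (fun z hz => ?_) (hC.prod isClosed_univ)
  by_contra h
  have h0 : slice ℂ z.1 f = 0 := by
    ext t
    change f (z.1, t) = 0
    exact image_eq_zero_of_notMem_tsupport fun ht => h ⟨(hf ht).1, trivial⟩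
  refine hz ?_
  change (𝓕 (slice ℂ z.1 f) : 𝓢(F, ℂ)) z.2 = 0
  rw [h0, FourierTransform.fourier_zero]
  rfl

/-- For the forward direction, a test function is the transform of its own threefold transform,
which is still supported in the cylinder. -/
theorem isVanishingOn_partialFourierDistribution_iff {C : Set E} (hC : IsClosed C)
    (Ψ : 𝓢'(E × F, ℂ)) :
    IsVanishingOn (partialFourierDistribution Ψ) (C ×ˢ Set.univ) ↔
      IsVanishingOn Ψ (C ×ˢ Set.univ) := by
  refine ⟨fun h f hf => ?_, fun h f hf => h _ (tsupport_partialFourier_subset hC hf)⟩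
  rw [← partialFourier_iterate_four f]
  exact h _ (tsupport_partialFourier_subset hC (tsupport_partialFourier_subset hC
    (tsupport_partialFourier_subset hC hf)))

end PartialFourierSupport

/-! ### Supports under change of variables, conjugation and tensor product -/

section Operations

variable {E F : Type} [NormedAddCommGroup E] [NormedSpace ℝ E]

/-- Composition with `M.symm` is a bijection from test functions supported in `M ⁻¹' s` to those
supported in `s`, and the Jacobian factor is nonzero. -/
theorem isVanishingOn_changeOfVar_iff (M : E ≃L[ℝ] E) (Ψ : 𝓢'(E, ℂ)) (s : Set E) :
    IsVanishingOn (changeOfVar M Ψ) (M ⁻¹' s) ↔ IsVanishingOn Ψ s := by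
  have hdet : ((|LinearMap.det (M : E →ₗ[ℝ] E)|⁻¹ : ℝ) : ℂ) ≠ 0 := by
    have := (LinearEquiv.isUnit_det' M.toLinearEquiv).ne_zero
    exact_mod_cast inv_ne_zero (abs_ne_zero.2 this)
  have key (f : 𝓢(E, ℂ)) : changeOfVar M Ψ f = 0 ↔
      Ψ (SchwartzMap.compCLMOfContinuousLinearEquiv ℂ M.symm f) = 0 := by
    change ((|LinearMap.det (M : E →ₗ[ℝ] E)|⁻¹ : ℝ) : ℂ) •
      Ψ (SchwartzMap.compCLMOfContinuousLinearEquiv ℂ M.symm f) = 0 ↔ _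
    rw [smul_eq_zero_iff_right hdet]
  have ht (N : E ≃L[ℝ] E) (f : 𝓢(E, ℂ)) :
      tsupport (SchwartzMap.compCLMOfContinuousLinearEquiv ℂ N f) = N ⁻¹' tsupport f :=
    tsupport_comp_eq_preimage f N.toHomeomorph
  refine ⟨fun h f hf => ?_, fun h f hf => (key f).2 (h _ ?_)⟩
  · have := (key _).1 (h (SchwartzMap.compCLMOfContinuousLinearEquiv ℂ M f) ?_)
    · convert this
      ext x
      simp
    · rw [ht]
      exact Set.preimage_mono hf
  · rw [ht]
    intro x hx
    have := hf hx
    simpa using this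

theorem tsupport_conjSchwartz (f : 𝓢(E, ℂ)) : tsupport (conjSchwartz f) = tsupport f := by
  refine congrArg closure (Set.ext fun x => ?_)
  change starRingEnd ℂ (f x) ≠ 0 ↔ f x ≠ 0
  simp

theorem conjSchwartz_conjSchwartz (f : 𝓢(E, ℂ)) : conjSchwartz (conjSchwartz f) = f := by
  ext x
  exact Complex.conj_conj (f x)

theorem conjDistribution_apply (μ : 𝓢'(E, ℂ)) (f : 𝓢(E, ℂ)) :
    conjDistribution μ f = starRingEnd ℂ (μ (conjSchwartz f)) := rfl

theorem isVanishingOn_conjDistribution_iff (μ : 𝓢'(E, ℂ)) (s : Set E) :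
    IsVanishingOn (conjDistribution μ) s ↔ IsVanishingOn μ s := by
  refine ⟨fun h f hf => ?_, fun h f hf => ?_⟩
  · have := h (conjSchwartz f) (by rwa [tsupport_conjSchwartz])
    rwa [conjDistribution_apply, conjSchwartz_conjSchwartz, map_eq_zero] at this
  · rw [conjDistribution_apply, h _ (by rwa [tsupport_conjSchwartz]), map_zero]

theorem dsupport_conjDistribution (μ : 𝓢'(E, ℂ)) : dsupport (conjDistribution μ) = dsupport μ := by
  simp only [dsupport, isVanishingOn_conjDistribution_iff]

variable [FiniteDimensional ℝ E] [NormedAddCommGroup F] [NormedSpace ℝ F]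

theorem tensor_apply (μ : 𝓢'(E, ℂ)) (ν : 𝓢'(F, ℂ)) (f : 𝓢(E × F, ℂ)) :
    tensor μ ν f = μ (partialPairing ν f) := rfl

theorem tensor_apply_prod (μ : 𝓢'(E, ℂ)) (ν : 𝓢'(F, ℂ)) (a : 𝓢(E, ℂ)) (b : 𝓢(F, ℂ))
    (f : 𝓢(E × F, ℂ)) (hf : ∀ x y, f (x, y) = a x * b y) : tensor μ ν f = μ a * ν b := by
  have h (x : E) : slice ℂ x f = a x • b := by
    ext y
    exact hf x y
  have e : partialPairing ν f = ν b • a := by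
    ext x
    change ν (slice ℂ x f) = ν b * a x
    rw [h, map_smul, smul_eq_mul, mul_comm]
  rw [tensor_apply, e, map_smul, smul_eq_mul, mul_comm]

/-- Test functions `a`, `b` near `x`, `y` with `μ a ≠ 0` and `ν b ≠ 0` combine to `a ⊗ b` near `(x,
y)`, on which the tensor product is `μ a * ν b ≠ 0`. -/
theorem prod_subset_dsupport_tensor [FiniteDimensional ℝ F] (μ : 𝓢'(E, ℂ)) (ν : 𝓢'(F, ℂ)) :
    dsupport μ ×ˢ dsupport ν ⊆ dsupport (tensor μ ν) := by
  rintro ⟨x, y⟩ ⟨hx, hy⟩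
  rw [mem_dsupport_iff_not_isVanishingOn]
  intro s hs hso hv
  obtain ⟨r, hr, hrs⟩ := Metric.nhds_basis_closedBall.mem_iff.1 (hso.mem_nhds hs)
  obtain ⟨a, has, ha⟩ := (mem_dsupport_iff_forall_exists_ne x).1 hx _
    (Metric.mem_ball_self hr) Metric.isOpen_ball
  obtain ⟨b, hbs, hb⟩ := (mem_dsupport_iff_forall_exists_ne y).1 hy _
    (Metric.mem_ball_self hr) Metric.isOpen_ball
  -- In the sup norm a product of balls is a ball; the compact support obtained here makes `a ⊗ b` a
  -- Schwartz function at once.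
  have hsub : Function.support (fun z : E × F => a z.1 * b z.2) ⊆ Metric.closedBall (x, y) r := by
    intro z hz
    rw [← closedBall_prod_same]
    exact ⟨Metric.ball_subset_closedBall (has (subset_closure (left_ne_zero_of_mul hz))),
      Metric.ball_subset_closedBall (hbs (subset_closure (right_ne_zero_of_mul hz)))⟩
  have hc : HasCompactSupport (fun z : E × F => a z.1 * b z.2) :=
    .of_support_subset_isCompact (isCompact_closedBall _ _) hsub
  have hd : ContDiff ℝ (⊤ : ℕ∞) (fun z : E × F => a z.1 * b z.2) :=
    ((a.smooth ⊤).comp contDiff_fst).mul ((b.smooth ⊤).comp contDiff_snd)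
  have h0 := hv (hc.toSchwartzMap hd) ((closure_minimal hsub Metric.isClosed_closedBall).trans hrs)
  rw [tensor_apply_prod μ ν a b _ fun x y => rfl] at h0
  exact mul_ne_zero ha hb h0

/-- For `x` within `δ` of some `u` in the support of `μ`, the slice `f (x, ·)` lives where `x - v ∈
D`. That set misses the support of `ν`, because `x - v` is within `δ` of `u - v`. The pairing with
`ν` thus vanishes near the support of `μ`. A uniform `δ` is essential: one neighbourhood of `u` must
serve every `v`. -/
theorem isVanishingOn_tensor_of_sub_mem {μ ν : 𝓢'(E, ℂ)} {D : Set E} (hD : IsClosed D) {δ : ℝ}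
    (hδ : 0 < δ) (h : ∀ u ∈ dsupport μ, ∀ v ∈ dsupport ν, Disjoint (Metric.ball (u - v) δ) D) :
    IsVanishingOn (tensor μ ν) {z | z.1 - z.2 ∈ D} := by
  intro f hf
  rw [tensor_apply]
  refine isVanishingOn_compl_dsupport μ _ fun u hu hu' => ?_
  refine notMem_tsupport_iff_eventuallyEq.2 ?_ hu
  filter_upwards [Metric.ball_mem_nhds u hδ] with x hx
  refine isVanishingOn_compl_dsupport ν _ fun v hv hv' => ?_
  have hcl : IsClosed {v | x - v ∈ D} := hD.preimage (continuous_const.sub continuous_id)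
  have hxv : x - v ∈ D :=
    closure_minimal (fun w (hw : f (x, w) ≠ 0) =>
      (hf (subset_closure hw) : (x, w) ∈ {z : E × E | z.1 - z.2 ∈ D})) hcl hv
  refine Set.disjoint_left.1 (h u hu' v hv') ?_ hxv
  rwa [Metric.mem_ball, dist_sub_right]

end Operations

/-! ### Discrete sets of differences -/

section Discrete

theorem IsDiscreteSet.mono {X : Type} [TopologicalSpace X] {S T : Set X} (h : IsDiscreteSet T)
    (hST : S ⊆ T) : IsDiscreteSet S :=
  fun x hx => h x (hx.mono (principal_mono.2 hST))

theorem IsDiscreteSet.isClosed {X : Type} [TopologicalSpace X] {S : Set X} (h : IsDiscreteSet S) :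
    IsClosed S :=
  isClosed_iff_accPt.2 fun x hx => (h x hx).elim

/-- Only the origin matters: a neighbourhood of `0` free of other points of `L ⁻¹' (S - S)` gives,
through `L`, a ball containing no nonzero difference. -/
theorem isUniformlyDiscrete_of_isDiscreteSet_sub {E : Type} [NormedAddCommGroup E]
    [NormedSpace ℝ E] {L : E ≃L[ℝ] E} {S : Set E}
    (h : IsDiscreteSet (L ⁻¹' (S - S))) : IsUniformlyDiscrete S := by
  have h0 := h 0
  rw [accPt_iff_nhds] at h0
  push Not at h0
  obtain ⟨U, hU, hUS⟩ := h0
  have hV : L.symm ⁻¹' U ∈ 𝓝 (0 : E) :=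
    L.symm.continuous.continuousAt.preimage_mem_nhds (by rwa [map_zero])
  obtain ⟨δ, hδ, hball⟩ := Metric.nhds_basis_ball.mem_iff.1 hV
  refine ⟨δ, hδ, fun r hr s hs hsr => ?_⟩
  by_contra! hlt
  have hmem : r - s ∈ Metric.ball (0 : E) δ := by rwa [mem_ball_zero_iff, ← dist_eq_norm]
  have := hUS (L.symm (r - s)) ⟨hball hmem, by
    rw [Set.mem_preimage, L.apply_symm_apply]
    exact Set.sub_mem_sub hr hs⟩
  rw [map_eq_zero_iff _ L.symm.injective, sub_eq_zero] at this
  exact hsr this.symm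

end Discrete

/-! ### Comparison of the projected support with the difference set -/

section Main

variable {E : Type} [NormedAddCommGroup E] [InnerProductSpace ℝ E] [FiniteDimensional ℝ E]
  [MeasurableSpace E] [BorelSpace E]

theorem isVanishingOn_partialFourier_changeOfVar_iff {M : (E × E) ≃L[ℝ] (E × E)} {L : E ≃L[ℝ] E}
    (hM : ∀ z, (M z).1 - (M z).2 = L z.1) (Ψ : 𝓢'(E × E, ℂ)) {D : Set E} (hD : IsClosed D) :
    IsVanishingOn (partialFourierDistribution (changeOfVar M Ψ)) ((L ⁻¹' D) ×ˢ Set.univ) ↔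
      IsVanishingOn Ψ {z | z.1 - z.2 ∈ D} := by
  have : M ⁻¹' {z | z.1 - z.2 ∈ D} = (L ⁻¹' D) ×ˢ Set.univ := by
    ext z
    simp [hM]
  rw [isVanishingOn_partialFourierDistribution_iff (hD.preimage L.continuous),
    ← isVanishingOn_changeOfVar_iff M Ψ, this]

theorem image_fst_dsupport_subset {M : (E × E) ≃L[ℝ] (E × E)} {L : E ≃L[ℝ] E}
    (hM : ∀ z, (M z).1 - (M z).2 = L z.1) (μ ν : 𝓢'(E, ℂ)) :
    Prod.fst '' dsupport (partialFourierDistribution (changeOfVar M (tensor μ ν))) ⊆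
      closure (L ⁻¹' (dsupport μ - dsupport ν)) := by
  rintro _ ⟨z, hz, rfl⟩
  have hcl : L ⁻¹' closure (dsupport μ - dsupport ν) = closure (L ⁻¹' (dsupport μ - dsupport ν)) :=
    L.toHomeomorph.preimage_closure _
  rw [← hcl]
  by_contra hx
  obtain ⟨r, hr, h⟩ := Metric.nhds_basis_ball.mem_iff.1
    (isClosed_closure.isOpen_compl.mem_nhds (x := L z.1) hx)
  -- The ball of radius `r` misses all differences of support points. Half of `r` is spent on the
  -- closed set `D`, the other half on the uniform margin `δ`.
  have hv := isVanishingOn_tensor_of_sub_mem (μ := μ) (ν := ν)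
    (D := Metric.closedBall (L z.1) (r / 2)) Metric.isClosed_closedBall (half_pos hr)
    fun u hu v hv => by
      refine Set.disjoint_left.2 fun w hw hw' => h ?_ (subset_closure (Set.sub_mem_sub hu hv))
      rw [Metric.mem_ball] at hw ⊢
      rw [Metric.mem_closedBall] at hw'
      linarith [dist_triangle_left (u - v) (L z.1) w]
  rw [← isVanishingOn_partialFourier_changeOfVar_iff hM _ Metric.isClosed_closedBall] at hv
  refine (notMem_dsupport_iff z).2 ⟨(L ⁻¹' Metric.ball (L z.1) (r / 2)) ×ˢ Set.univ,
    hv.mono (Set.prod_mono (Set.preimage_mono Metric.ball_subset_closedBall) subset_rfl),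
    (Metric.isOpen_ball.preimage L.continuous).prod isOpen_univ, ?_, trivial⟩ hz
  exact Metric.mem_ball_self (half_pos hr)

/-- If `x` were away from the projected support, the transform would vanish on a cylinder around
`x`, hence the tensor product on a band around `(u, v)`, a point of its support. -/
theorem preimage_sub_subset_closure {M : (E × E) ≃L[ℝ] (E × E)} {L : E ≃L[ℝ] E}
    (hM : ∀ z, (M z).1 - (M z).2 = L z.1) (μ ν : 𝓢'(E, ℂ)) :
    L ⁻¹' (dsupport μ - dsupport ν) ⊆ closure (Prod.fst ''
      dsupport (partialFourierDistribution (changeOfVar M (tensor μ ν)))) := by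
  rintro x ⟨u, hu, v, hv, huv⟩
  by_contra hx
  have hx' : L.symm ⁻¹' (closure (Prod.fst '' dsupport (partialFourierDistribution
      (changeOfVar M (tensor μ ν)))))ᶜ ∈ 𝓝 (L x) := by
    refine (isClosed_closure.isOpen_compl.preimage L.symm.continuous).mem_nhds ?_
    rwa [Set.mem_preimage, L.symm_apply_apply]
  obtain ⟨r, hr, h⟩ := Metric.nhds_basis_closedBall.mem_iff.1 hx'
  have hvan : IsVanishingOn (partialFourierDistribution (changeOfVar M (tensor μ ν)))
      ((L ⁻¹' Metric.closedBall (L x) r) ×ˢ Set.univ) := by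
    have hsub : (L ⁻¹' Metric.closedBall (L x) r) ×ˢ Set.univ ⊆
        (dsupport (partialFourierDistribution (changeOfVar M (tensor μ ν))))ᶜ := by
      intro z hz hz'
      have := h hz.1
      rw [Set.mem_preimage, L.symm_apply_apply] at this
      exact this (subset_closure ⟨z, hz', rfl⟩)
    exact (isVanishingOn_compl_dsupport _).mono hsub
  rw [isVanishingOn_partialFourier_changeOfVar_iff hM _ Metric.isClosed_closedBall] at hvan
  have huv' : (u, v) ∈ dsupport (tensor μ ν) := prod_subset_dsupport_tensor μ ν ⟨hu, hv⟩
  refine (mem_dsupport_iff_not_isVanishingOn _).1 huv'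
    {z | z.1 - z.2 ∈ Metric.ball (L x) r} ?_
    (Metric.isOpen_ball.preimage (continuous_fst.sub continuous_snd))
    (hvan.mono fun z (hz : z.1 - z.2 ∈ Metric.ball (L x) r) =>
      show z.1 - z.2 ∈ _ from Metric.ball_subset_closedBall hz)
  change u - v ∈ Metric.ball (L x) r
  rw [show u - v = L x from huv]
  exact Metric.mem_ball_self hr

theorem image_fst_dsupport_eq_and_isUniformlyDiscrete {M : (E × E) ≃L[ℝ] (E × E)} {L : E ≃L[ℝ] E}
    (hM : ∀ z, (M z).1 - (M z).2 = L z.1) (μ : 𝓢'(E, ℂ))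
    (h : IsDiscreteSet (Prod.fst '' dsupport (partialFourierDistribution
      (changeOfVar M (tensor μ (conjDistribution μ)))))) :
    Prod.fst '' dsupport (partialFourierDistribution
      (changeOfVar M (tensor μ (conjDistribution μ)))) = L ⁻¹' (dsupport μ - dsupport μ) ∧
      IsUniformlyDiscrete (dsupport μ) := by
  have h1 := image_fst_dsupport_subset hM μ (conjDistribution μ)
  have h2 := preimage_sub_subset_closure hM μ (conjDistribution μ)
  rw [h.isClosed.closure_eq] at h2
  rw [dsupport_conjDistribution] at h1 h2
  -- The order matters: the second inclusion, already free of its closure, makes the difference set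
  -- discrete and hence closed, and this frees the first.
  have hP := h.mono h2
  rw [hP.isClosed.closure_eq] at h1
  exact ⟨h1.antisymm h2, isUniformlyDiscrete_of_isDiscreteSet_sub hP⟩

/-- The linear automorphism of `ℝᵈ` given by an invertible matrix. -/
noncomputable def matrixEquiv {d : ℕ} (A : Matrix (Fin d) (Fin d) ℝ) (h : A.det ≠ 0) :
    EuclideanSpace ℝ (Fin d) ≃L[ℝ] EuclideanSpace ℝ (Fin d) :=
  (LinearEquiv.ofLinearMap (Matrix.toEuclideanLin A) (Matrix.toEuclideanLin A⁻¹)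
    (by rw [← Matrix.toLpLin_mul_same, Matrix.mul_nonsing_inv _ h.isUnit, Matrix.toLpLin_one])
    (by rw [← Matrix.toLpLin_mul_same, Matrix.nonsing_inv_mul _ h.isUnit,
      Matrix.toLpLin_one])).toContinuousLinearEquiv

theorem image_fst_dsupport_matrixWigner {d : ℕ} (μ : 𝓢'(EuclideanSpace ℝ (Fin d), ℂ))
    (A₀ C₀ : Matrix (Fin d) (Fin d) ℝ) (h : (A₀ - C₀).det ≠ 0)
    (hd : IsDiscreteSet (Prod.fst '' dsupport
      (matrixWigner (Matrix.fromBlocks A₀ 1 C₀ 1) (isUnit_det_fromBlocks h) μ))) :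
    Prod.fst '' dsupport (matrixWigner (Matrix.fromBlocks A₀ 1 C₀ 1) (isUnit_det_fromBlocks h) μ) =
        Matrix.toEuclideanLin (A₀ - C₀)⁻¹ '' (dsupport μ - dsupport μ) ∧
      IsUniformlyDiscrete (dsupport μ) := by
  -- The two `t` terms cancel because both right-hand blocks are the identity.
  have hM (z) : (blockEquiv (Matrix.fromBlocks A₀ 1 C₀ 1) (isUnit_det_fromBlocks h) z).1 -
      (blockEquiv (Matrix.fromBlocks A₀ 1 C₀ 1) (isUnit_det_fromBlocks h) z).2 =
        matrixEquiv (A₀ - C₀) h z.1 := by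
    obtain ⟨x, t⟩ := z
    rw [blockEquiv_apply, add_sub_add_right_eq_sub]
    change _ = Matrix.toEuclideanLin (A₀ - C₀) x
    rw [map_sub, LinearMap.sub_apply]
  have e (S : Set (EuclideanSpace ℝ (Fin d))) :
      Matrix.toEuclideanLin (A₀ - C₀)⁻¹ '' S = matrixEquiv (A₀ - C₀) h ⁻¹' S :=
    (matrixEquiv (A₀ - C₀) h).symm.toEquiv.image_eq_preimage_symm S
  rw [e]
  exact image_fst_dsupport_eq_and_isUniformlyDiscrete hM μ hd

end Main

end MatrixWigner

theorem mainTheorem4 (d : ℕ) (μ : 𝓢'(EuclideanSpace ℝ (Fin d), ℂ)) :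
    (∀ (A₀ C₀ : Matrix (Fin d) (Fin d) ℝ) (h : (A₀ - C₀).det ≠ 0),
      MatrixWigner.IsDiscreteSet (Prod.fst '' Distribution.dsupport
        (MatrixWigner.matrixWigner (Matrix.fromBlocks A₀ 1 C₀ 1)
          (MatrixWigner.isUnit_det_fromBlocks h) μ)) →
      Prod.fst '' Distribution.dsupport
          (MatrixWigner.matrixWigner (Matrix.fromBlocks A₀ 1 C₀ 1)
            (MatrixWigner.isUnit_det_fromBlocks h) μ) =
          Matrix.toEuclideanLin (A₀ - C₀)⁻¹ ''
            (Distribution.dsupport μ - Distribution.dsupport μ) ∧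
        MatrixWigner.IsUniformlyDiscrete (Distribution.dsupport μ)) ∧
    (MatrixWigner.IsDiscreteSet
        (Prod.fst '' Distribution.dsupport (MatrixWigner.ambiguity μ)) →
      Prod.fst '' Distribution.dsupport (MatrixWigner.ambiguity μ) =
        Distribution.dsupport μ - Distribution.dsupport μ) := by
  refine ⟨MatrixWigner.image_fst_dsupport_matrixWigner μ, fun h => ?_⟩
  -- For the ambiguity function `A₀ - C₀` is the identity, so no linear map remains in front of the
  -- difference set.
  have h1 : (1 / 2 : ℝ) • (1 : Matrix (Fin d) (Fin d) ℝ) - (-(1 / 2) : ℝ) • 1 = 1 := by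
    rw [← sub_smul]
    norm_num
  have h2 := (MatrixWigner.image_fst_dsupport_matrixWigner μ _ _ (MatrixWigner.det_half_sub d) h).1
  rw [h1, inv_one, Matrix.toLpLin_one, LinearMap.id_coe, Set.image_id] at h2
  exact h2
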